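/- Fix integers $n>1$ and $t\ge 1$, and let $k$ be an integer with $0\le k\le t(n-1)$. Set $b=\lfloor k/t\rfloor$ and $c=\lceil k/t\rceil$. Then the number of subgroups of order $p^k$ in $(\mathbb{Z}/p^t\mathbb{Z})^{n-1}$ is a polynomial in $p$ of degree $$k(n-1)-c^2(k+t-ct)-b^2(ct-k);$$ that is, there is a nonzero polynomial $P\in\mathbb{Z}[X]$ of this degree, depending only on $n$, $t$ and $k$, such that for every prime $p$ the number of subgroups of order $p^k$ in $(\mathbb{Z}/p^t\mathbb{Z})^{n-1}$ equals $P(p)$. -/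

import Mathlib

/-!
A subgroup of `(ℤ / p ^ t) ^ m` is the same as a subgroup `L` of `A = ℤ ^ m` containing `p ^ t A`.
Attach to `L` the subgroup `M = {x | p • x ∈ L}`, which contains `p ^ (t - 1) A`. Then
`pM ≤ L ≤ M`, the quotient `M / pM` is an `m`-dimensional `𝔽_p`-space because `M` has finite index
in `A` (`relIndex_map_self`), and since `L ∩ pA = pM`, the subgroups `L` with a given `M` are the
subspaces of `M / pM` that meet `(M ∩ pA) / pM` trivially. If the image of `M` in `A / pA` has
dimension `r`, this last space has dimension `m - r`, and the number of `s`-dimensional subspaces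
avoiding it is `p ^ (s * (m - r))` times the Gaussian binomial coefficient `[r choose s]_p`
(`card_submodule_disjoint`, `card_addSubgroup_comap_nsmul_eq`). Moreover `s` is then the dimension
of the image of `L` in `A / pA`, so the construction can be iterated. This gives the recursive
polynomials `subgroupPoly`, which count by `card_levelSubgroups`.

Unfolded, the count is a sum over chains `m ≥ s₁ ≥ ⋯ ≥ s_t` with `∑ sᵢ = k` of monic polynomials of
degree `∑ sᵢ (m - sᵢ)`. All polynomials have natural number coefficients, so nothing cancels and
the degree is the maximum over the chains. By concavity of `s ↦ s (m - s)` it is attained when all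
`sᵢ` are `b = ⌊k / t⌋` or `b + 1` (`natDegree_subgroupPoly_le`, `natDegree_sum_subgroupPoly`).
-/

/-! ### Gaussian binomial coefficients -/

open Polynomial in
/-- The Gaussian binomial coefficient `[r choose s]_q` as a polynomial in `q` with natural number
coefficients, defined by the `q`-Pascal recursion. It vanishes for `r < s`. -/
noncomputable def gaussBinom : ℕ → ℕ → ℕ[X]
  | _, 0 => 1
  | 0, _ + 1 => 0
  | r + 1, s + 1 => gaussBinom r s + X ^ (s + 1) * gaussBinom r (s + 1)

theorem gaussBinom_eq_zero {r s : ℕ} (h : r < s) : gaussBinom r s = 0 := by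
  induction r generalizing s with
  | zero => cases s <;> simp_all [gaussBinom]
  | succ r ih =>
    obtain _ | s := s
    · omega
    · simp [gaussBinom, ih (show r < s by omega), ih (show r < s + 1 by omega)]

theorem gaussBinom_ne_zero {r s : ℕ} (h : s ≤ r) : gaussBinom r s ≠ 0 := by
  induction r generalizing s with
  | zero => simp_all [gaussBinom]
  | succ r ih =>
    obtain _ | s := s
    · simp [gaussBinom]
    · intro h0
      obtain ⟨i, hi⟩ := Polynomial.support_nonempty.2 (ih (show s ≤ r by omega))
      have := congrArg (fun P => P.coeff i) h0
      simp [gaussBinom] at this hi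
      omega

theorem natDegree_gaussBinom {r s : ℕ} (h : s ≤ r) :
    (gaussBinom r s).natDegree = s * (r - s) := by
  induction r generalizing s with
  | zero => simp_all [gaussBinom]
  | succ r ih =>
    obtain _ | s := s
    · simp [gaussBinom]
    · obtain rfl | hs := (show s ≤ r by omega).eq_or_lt
      · simp [gaussBinom, gaussBinom_eq_zero (Nat.lt_succ_self s), ih le_rfl]
      · have h1 := ih hs.le
        have h2 : (Polynomial.X ^ (s + 1) * gaussBinom r (s + 1)).natDegree =
            (s + 1) * (r - s) := by
          rw [Polynomial.natDegree_mul (by simp) (gaussBinom_ne_zero hs),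
            Polynomial.natDegree_X_pow, ih hs]
          obtain ⟨d, rfl⟩ := Nat.exists_eq_add_of_lt hs
          rw [show s + d + 1 - (s + 1) = d by omega, show s + d + 1 - s = d + 1 by omega]
          simp only [Nat.succ_eq_add_one]
          ring
        rw [gaussBinom, Polynomial.natDegree_add_eq_right_of_natDegree_lt, h2]
        · congr 1; omega
        · rw [h1, h2]
          exact Nat.mul_lt_mul_of_pos_right (Nat.lt_succ_self s) (by omega)

/-- For a prime power `q`, the Gaussian binomial coefficient is the quotient of the number of linearly independent
`s`-tuples in an `r`-dimensional space by the number of those in an `s`-dimensional space. -/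
theorem eval_gaussBinom_mul_prod (q r s : ℕ) :
    (((gaussBinom r s).eval q : ℕ) : ℤ) * ∏ i ∈ Finset.range s, ((q : ℤ) ^ s - q ^ i) =
      ∏ i ∈ Finset.range s, ((q : ℤ) ^ r - q ^ i) := by
  -- Pulling the factor `i = 0` out of the product and one power of `q` out of the others.
  have key (r s : ℕ) : ∏ i ∈ Finset.range (s + 1), ((q : ℤ) ^ (r + 1) - q ^ i) =
      (q ^ (r + 1) - 1) * (q ^ s * ∏ i ∈ Finset.range s, ((q : ℤ) ^ r - q ^ i)) := by
    rw [Finset.prod_range_succ', mul_comm, pow_zero]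
    congr 1
    rw [← Finset.card_range s, ← Finset.prod_const, Finset.card_range, ← Finset.prod_mul_distrib]
    exact Finset.prod_congr rfl fun i _ => by ring
  induction r generalizing s with
  | zero =>
    obtain _ | s := s
    · simp [gaussBinom]
    · simp [gaussBinom, Finset.prod_range_succ']
  | succ r ih =>
    obtain _ | s := s
    · simp [gaussBinom]
    · have h1 := ih s
      have h2 := ih (s + 1)
      rw [key s s, Finset.prod_range_succ] at h2
      rw [key s s, key r s, gaussBinom]
      simp only [Polynomial.eval_add, Polynomial.eval_mul, Polynomial.eval_pow, Polynomial.eval_X]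
      push_cast
      linear_combination (q ^ (s + 1) - 1) * q ^ s * h1 + q ^ (s + 1) * h2

/-! ### Subspaces avoiding a given subspace -/

/-- Each linearly independent tuple in `V ⧸ T` has as many lifts to `V` as there are tuples
in `T`. -/
theorem card_linearIndependent_mkQ {K V : Type*} [Field K] [Finite K] [AddCommGroup V] [Module K V]
    [Finite V] (T : Submodule K V) (s : ℕ) :
    (Nat.card {w : Fin s → V // LinearIndependent K (T.mkQ ∘ w)} : ℤ) =
      (Nat.card K : ℤ) ^ (s * Module.finrank K T) *
        ∏ i ∈ Finset.range s,
          ((Nat.card K : ℤ) ^ (Module.finrank K V - Module.finrank K T) - Nat.card K ^ i) := by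
  classical
  have := Fintype.ofFinite K
  have : Finite (V ⧸ T) := Finite.of_surjective _ T.mkQ_surjective
  have hr : Module.finrank K (V ⧸ T) = Module.finrank K V - Module.finrank K T := by
    have := T.finrank_quotient_add_finrank
    omega
  have hcard : Nat.card {w : Fin s → V // LinearIndependent K (T.mkQ ∘ w)} =
      Nat.card ({u : Fin s → V ⧸ T // LinearIndependent K u} × (Fin s → T)) := by
    obtain ⟨σ, hσ⟩ := T.mkQ.exists_rightInverse_of_surjective (Submodule.range_mkQ T)
    have hσ' (x : V ⧸ T) : T.mkQ (σ x) = x := LinearMap.congr_fun hσ x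
    symm
    have hq (u : Fin s → V ⧸ T) (a : Fin s → T) :
        (T.mkQ ∘ fun i => σ (u i) + (a i : V)) = u := by
      funext i
      simp only [Function.comp_apply, map_add, hσ']
      simp
    refine Nat.card_eq_of_bijective
      (fun x => ⟨fun i => σ (x.1.1 i) + (x.2 i : V), by rw [hq]; exact x.1.2⟩) ⟨?_, ?_⟩
    · rintro ⟨⟨u, hu⟩, a⟩ ⟨⟨u', hu'⟩, a'⟩ h
      have h1 : (fun i => σ (u i) + (a i : V)) = fun i => σ (u' i) + (a' i : V) :=
        congrArg Subtype.val h
      obtain rfl : u = u' := by rw [← hq u a, h1, hq]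
      simpa [funext_iff] using h1
    · rintro ⟨w, hw⟩
      refine ⟨⟨⟨T.mkQ ∘ w, hw⟩, fun i => ⟨w i - σ (T.mkQ (w i)), ?_⟩⟩, ?_⟩
      · rw [← Submodule.Quotient.mk_eq_zero, ← T.mkQ_apply, map_sub, hσ', sub_self]
      · ext i
        simp
  rw [hcard, Nat.card_prod, Nat.card_fun, Nat.card_fin, Module.natCard_eq_pow_finrank (K := K)
    (V := T), ← pow_mul, mul_comm (Module.finrank K T) s, mul_comm, ← hr]
  push_cast
  congr 1
  obtain hs | hs := le_or_gt s (Module.finrank K (V ⧸ T))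
  · rw [card_linearIndependent hs, Nat.card_eq_fintype_card, Finset.prod_range]
    push_cast
    refine Finset.prod_congr rfl fun i _ => ?_
    rw [Nat.cast_sub (Nat.pow_le_pow_right Fintype.card_pos (by omega))]
    push_cast
    rfl
  · have : IsEmpty {u : Fin s → V ⧸ T // LinearIndependent K u} := by
      refine ⟨fun u => ?_⟩
      have := u.2.fintype_card_le_finrank
      simp at this
      omega
    rw [Finset.prod_eq_zero (Finset.mem_range.2 hs) (sub_self _)]
    simp

/-- The number of `s`-dimensional subspaces meeting a given subspace `T` trivially. Such subspaces
together with a basis are the tuples that are linearly independent modulo `T`. -/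
theorem card_submodule_disjoint {K V : Type*} [Field K] [Finite K] [AddCommGroup V] [Module K V]
    [Finite V] (T : Submodule K V) (s : ℕ) :
    Nat.card {U : Submodule K V // Disjoint U T ∧ Module.finrank K U = s} =
      Nat.card K ^ (s * Module.finrank K T) *
        (gaussBinom (Module.finrank K V - Module.finrank K T) s).eval (Nat.card K) := by
  classical
  have := Fintype.ofFinite K
  have : Finite (Submodule K V) := Finite.of_injective _ SetLike.coe_injective
  have := Fintype.ofFinite {U : Submodule K V // Disjoint U T ∧ Module.finrank K U = s}
  have h1 : Nat.card {w : Fin s → V // LinearIndependent K (T.mkQ ∘ w)} =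
      Nat.card (Σ U : {U : Submodule K V // Disjoint U T ∧ Module.finrank K U = s},
        {b : Fin s → U.1 // LinearIndependent K b}) := by
    symm
    have hspan (U : Submodule K V) (hU : Module.finrank K U = s) (b : Fin s → U)
        (hb : LinearIndependent K b) :
        Submodule.span K (Set.range fun i => (b i : V)) = U := by
      have := hb.span_eq_top_of_card_eq_finrank' (by simp [hU])
      have h2 := congrArg (Submodule.map U.subtype) this
      rw [Submodule.map_span, ← Set.range_comp, Submodule.map_subtype_top] at h2
      exact h2
    refine Nat.card_eq_of_bijective (fun x => ⟨fun i => (x.2.1 i : V), ?_⟩) ⟨?_, ?_⟩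
    · have : LinearMap.ker (T.mkQ ∘ₗ x.1.1.subtype) = ⊥ := by
        rw [LinearMap.ker_comp, Submodule.ker_mkQ, ← Submodule.disjoint_iff_comap_eq_bot]
        exact x.1.2.1
      exact x.2.2.map' _ this
    · rintro ⟨⟨U, hU⟩, b, hb⟩ ⟨⟨U', hU'⟩, b', hb'⟩ h
      have h1 : (fun i => (b i : V)) = fun i => (b' i : V) := congrArg Subtype.val h
      obtain rfl : U = U' := by rw [← hspan U hU.2 b hb, h1, hspan U' hU'.2 b' hb']
      obtain rfl : b = b' := by
        funext i
        exact Subtype.ext (congrFun h1 i)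
      rfl
    · rintro ⟨w, hw⟩
      have hw' : LinearIndependent K w := LinearIndependent.of_comp _ hw
      have hd : Disjoint (Submodule.span K (Set.range w)) T := by
        simpa using Submodule.range_ker_disjoint hw
      refine ⟨⟨⟨Submodule.span K (Set.range w), hd, by simpa using finrank_span_eq_card hw'⟩,
        fun i => ⟨w i, Submodule.subset_span ⟨i, rfl⟩⟩, linearIndependent_span hw'⟩, rfl⟩
  have h2 := card_linearIndependent_mkQ T s
  set q := Nat.card K with hq
  have hq1 : 1 < q := Finite.one_lt_card
  have h3 (U : {U : Submodule K V // Disjoint U T ∧ Module.finrank K U = s}) :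
      (Nat.card {b : Fin s → U.1 // LinearIndependent K b} : ℤ) =
        ∏ i ∈ Finset.range s, ((q : ℤ) ^ s - q ^ i) := by
    rw [card_linearIndependent U.2.2.ge, ← Nat.card_eq_fintype_card, ← hq, Finset.prod_range, U.2.2]
    push_cast
    refine Finset.prod_congr rfl fun i _ => ?_
    rw [Nat.cast_sub (Nat.pow_le_pow_right (by omega) (by omega))]
    push_cast
    rfl
  rw [h1, Nat.card_sigma, Nat.cast_sum, Finset.sum_congr rfl (fun U _ => h3 U), Finset.sum_const,
    Finset.card_univ, ← Nat.card_eq_fintype_card, nsmul_eq_mul,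
    ← eval_gaussBinom_mul_prod q (Module.finrank K V - Module.finrank K T),
    ← mul_assoc] at h2
  have h4 : ∏ i ∈ Finset.range s, ((q : ℤ) ^ s - q ^ i) ≠ 0 := by
    refine Finset.prod_ne_zero_iff.2 fun i hi => sub_ne_zero.2 fun h => ?_
    have := Nat.pow_right_injective hq1 (by exact_mod_cast h : q ^ s = q ^ i)
    simp at hi
    omega
  exact_mod_cast mul_right_cancel₀ h4 h2

/-! ### Subgroups with a given preimage under multiplication by `p` -/

theorem relIndex_range_eq_relIndex_map_comap {A : Type*} [AddCommGroup A] (φ : A →+ A)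
    (L : AddSubgroup A) : φ.range.relIndex L = ((L.comap φ).map φ).relIndex L := by
  rw [AddSubgroup.map_comap_eq, AddSubgroup.inf_relIndex_right]

/-- If `φ` is an injective endomorphism, every subgroup of finite index has the same index over its
image under `φ`. -/
theorem relIndex_map_self {A : Type*} [AddCommGroup A] {φ : A →+ A}
    (hφ : Function.Injective φ) {M : AddSubgroup A} (hM : M.index ≠ 0) (h : M.map φ ≤ M) :
    (M.map φ).relIndex M = φ.range.index := by
  have h1 := AddSubgroup.relIndex_mul_index h
  rw [AddSubgroup.index_map_of_injective M hφ, mul_comm] at h1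
  exact mul_left_cancel₀ hM h1

theorem finrank_zmod_eq_iff {p d : ℕ} [hp : Fact p.Prime] {W : Type*} [AddCommGroup W]
    [Module (ZMod p) W] [Finite W] (U : Submodule (ZMod p) W) :
    Module.finrank (ZMod p) U = d ↔ Nat.card U = p ^ d := by
  rw [Module.natCard_eq_pow_finrank (K := ZMod p) (V := U), Nat.card_zmod]
  exact (Nat.pow_right_injective hp.out.two_le).eq_iff.symm

/-- Subgroups `L` of `A` with a prescribed preimage `M = {x | p • x ∈ L}` and with image of
order `p ^ s` in `A / pA` correspond to the `s`-dimensional subspaces of a model `W` of the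
`𝔽_p`-space `M / pM` that meet the image of `M ∩ pA` trivially. -/
theorem card_addSubgroup_comap_nsmul_eq_card_submodule {A W : Type*} [AddCommGroup A]
    [AddCommGroup W] {p : ℕ} [Fact p.Prime] [Module (ZMod p) W] [Finite W]
    (hinj : Function.Injective (nsmulAddMonoidHom p : A →+ A)) {M : AddSubgroup A}
    {π : M →+ W} (hπ : Function.Surjective π)
    (hker : π.ker = (M.map (nsmulAddMonoidHom p)).addSubgroupOf M) (s : ℕ) :
    Nat.card {L : AddSubgroup A // L.comap (nsmulAddMonoidHom p) = M ∧
      (nsmulAddMonoidHom p : A →+ A).range.relIndex L = p ^ s} =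
    Nat.card {U : Submodule (ZMod p) W // Disjoint U (AddSubgroup.toZModSubmodule p
      (((nsmulAddMonoidHom p : A →+ A).range.addSubgroupOf M).map π)) ∧
        Module.finrank (ZMod p) U = s} := by
  set φ : A →+ A := nsmulAddMonoidHom p
  have hle : M.map φ ≤ M := by
    rintro _ ⟨x, hx, rfl⟩
    exact M.nsmul_mem hx p
  have hmapN : ((M.map φ).addSubgroupOf M).map M.subtype = M.map φ := by
    rw [AddSubgroup.addSubgroupOf_map_subtype, inf_eq_left.2 hle]
  -- The subgroup of `A` corresponding to a subgroup of `W`.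
  let lift (S : AddSubgroup W) : AddSubgroup A := (S.comap π).map M.subtype
  have hrel (S : AddSubgroup W) : (M.map φ).relIndex (lift S) = Nat.card S := by
    rw [← hmapN, ← hker, AddSubgroup.relIndex_map_map_of_injective _ _ M.subtype_injective,
      AddSubgroup.relIndex_ker, AddSubgroup.map_comap_eq_self_of_surjective hπ]
  have hRel (L : AddSubgroup A) (hL : L.comap φ = M) : φ.range.relIndex L = (M.map φ).relIndex L := by
    rw [relIndex_range_eq_relIndex_map_comap, hL]
  symm
  have hcomap (U : Submodule (ZMod p) W)
      (hU : Disjoint U (AddSubgroup.toZModSubmodule p ((φ.range.addSubgroupOf M).map π))) :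
      (lift U.toAddSubgroup).comap φ = M := by
    ext x
    constructor
    · rintro ⟨⟨y, hy⟩, hyU, hyx⟩
      obtain rfl : y = φ x := hyx
      have h0 : π ⟨φ x, hy⟩ = 0 :=
        Submodule.disjoint_def.1 hU _ hyU ⟨⟨φ x, hy⟩, ⟨x, rfl⟩, rfl⟩
      rw [← AddMonoidHom.mem_ker, hker] at h0
      obtain ⟨z, hz, hzx⟩ := h0
      rwa [← hinj hzx]
    · intro hx
      refine ⟨⟨φ x, hle ⟨x, hx, rfl⟩⟩, ?_, rfl⟩
      have h0 : π ⟨φ x, hle ⟨x, hx, rfl⟩⟩ = 0 := by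
        rw [← AddMonoidHom.mem_ker, hker]
        exact ⟨x, hx, rfl⟩
      change π _ ∈ U
      rw [h0]
      exact U.zero_mem
  refine Nat.card_eq_of_bijective (fun U => ⟨lift U.1.toAddSubgroup, hcomap U.1 U.2.1, ?_⟩) ⟨?_, ?_⟩
  · rw [hRel _ (hcomap U.1 U.2.1), hrel]
    exact (finrank_zmod_eq_iff U.1).1 U.2.2
  · intro U U' h
    have h1 := AddSubgroup.map_injective M.subtype_injective (congrArg Subtype.val h)
    exact Subtype.ext (Submodule.toAddSubgroup_injective (AddSubgroup.comap_injective hπ h1))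
  · rintro ⟨L, hLM, hL⟩
    have hmem (x : A) (hx : φ x ∈ L) : x ∈ M := by rw [← hLM]; exact hx
    have hle1 : M.map φ ≤ L := by rw [← hLM]; exact AddSubgroup.map_comap_le _ _
    have hle2 : L ≤ M := fun x hx => hmem x (L.nsmul_mem hx p)
    have hco : ((L.addSubgroupOf M).map π).comap π = L.addSubgroupOf M :=
      AddSubgroup.comap_map_eq_self (by rw [hker]; exact AddSubgroup.comap_mono hle1)
    have hlift : lift ((L.addSubgroupOf M).map π) = L := by
      change (((L.addSubgroupOf M).map π).comap π).map M.subtype = L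
      rw [hco, AddSubgroup.addSubgroupOf_map_subtype, inf_eq_left.2 hle2]
    refine ⟨⟨AddSubgroup.toZModSubmodule p ((L.addSubgroupOf M).map π), ?_, ?_⟩,
      Subtype.ext hlift⟩
    · rw [Submodule.disjoint_def]
      intro x hx hx'
      obtain ⟨y, ⟨z, hz⟩, rfl⟩ := hx'
      have hyL : y ∈ ((L.addSubgroupOf M).map π).comap π := hx
      rw [hco] at hyL
      change φ z = y at hz
      have hyL' : φ z ∈ L := by rw [hz]; exact hyL
      rw [← AddMonoidHom.mem_ker, hker]
      exact ⟨z, hmem z hyL', hz⟩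
    · rw [finrank_zmod_eq_iff]
      exact (hrel _).symm.trans (by rw [hlift, ← hRel L hLM, hL])

/-- The count for an abstract model `W` of `M / pM`, whose `ZMod p`-module structure is then a
genuine instance argument. -/
theorem card_addSubgroup_comap_nsmul_eq_of_card {A W : Type*} [AddCommGroup A]
    [AddCommGroup W] {p m r : ℕ} [hp : Fact p.Prime] [Module (ZMod p) W] [Finite W]
    (hinj : Function.Injective (nsmulAddMonoidHom p : A →+ A)) {M : AddSubgroup A}
    {π : M →+ W} (hπ : Function.Surjective π)
    (hker : π.ker = (M.map (nsmulAddMonoidHom p)).addSubgroupOf M) (hW : Nat.card W = p ^ m)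
    (hr : (nsmulAddMonoidHom p : A →+ A).range.relIndex M = p ^ r) (hrm : r ≤ m) (s : ℕ) :
    Nat.card {L : AddSubgroup A // L.comap (nsmulAddMonoidHom p) = M ∧
      (nsmulAddMonoidHom p : A →+ A).range.relIndex L = p ^ s} =
      p ^ (s * (m - r)) * (gaussBinom r s).eval p := by
  set φ : A →+ A := nsmulAddMonoidHom p
  rw [card_addSubgroup_comap_nsmul_eq_card_submodule hinj hπ hker s, card_submodule_disjoint]
  have hfinW : Module.finrank (ZMod p) W = m := by
    have := Module.natCard_eq_pow_finrank (K := ZMod p) (V := W)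
    rw [Nat.card_zmod, hW] at this
    exact (Nat.pow_right_injective hp.out.two_le this).symm
  have hle : (M.map φ).addSubgroupOf M ≤ φ.range.addSubgroupOf M :=
    AddSubgroup.comap_mono (by rintro _ ⟨x, -, rfl⟩; exact ⟨x, rfl⟩)
  have hfinT : Module.finrank (ZMod p) (AddSubgroup.toZModSubmodule p
      ((φ.range.addSubgroupOf M).map π)) = m - r := by
    rw [finrank_zmod_eq_iff]
    have h1 : ((φ.range.addSubgroupOf M).map π).index = p ^ r := by
      rw [AddSubgroup.index_map_eq _ hπ (by rwa [hker]), ← hr]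
      rfl
    have h2 := ((φ.range.addSubgroupOf M).map π).card_mul_index
    rw [h1, hW, ← Nat.sub_add_cancel hrm, pow_add] at h2
    exact Nat.eq_of_mul_eq_mul_right (pow_pos hp.out.pos r) h2
  rw [hfinT, hfinW, Nat.card_zmod, Nat.sub_sub_self hrm]

/-- The number of subgroups `L` with a prescribed preimage `M = {x | p • x ∈ L}` and with image of
order `p ^ s` in `A / pA`. They correspond to subspaces of the
`m`-dimensional `𝔽_p`-space `M / pM` that meet the `(m - r)`-dimensional subspace
`(M ∩ pA) / pM` trivially. -/
theorem card_addSubgroup_comap_nsmul_eq {A : Type*} [AddCommGroup A] {p m r : ℕ} (hp : p.Prime)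
    (hinj : Function.Injective (nsmulAddMonoidHom p : A →+ A))
    (hidx : (nsmulAddMonoidHom p : A →+ A).range.index = p ^ m)
    {M : AddSubgroup A} (hM : M.index ≠ 0)
    (hr : (nsmulAddMonoidHom p : A →+ A).range.relIndex M = p ^ r) (hrm : r ≤ m) (s : ℕ) :
    Nat.card {L : AddSubgroup A // L.comap (nsmulAddMonoidHom p) = M ∧
      (nsmulAddMonoidHom p : A →+ A).range.relIndex L = p ^ s} =
      p ^ (s * (m - r)) * (gaussBinom r s).eval p := by
  set φ : A →+ A := nsmulAddMonoidHom p
  have hle : M.map φ ≤ M := by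
    rintro _ ⟨x, hx, rfl⟩
    exact M.nsmul_mem hx p
  set N : AddSubgroup M := (M.map φ).addSubgroupOf M
  have : Fact p.Prime := ⟨hp⟩
  let _ : Module (ZMod p) (M ⧸ N) := AddCommGroup.zmodModule (n := p) fun x => by
    obtain ⟨y, rfl⟩ := QuotientAddGroup.mk'_surjective N x
    rw [← map_nsmul, ← AddMonoidHom.mem_ker, QuotientAddGroup.ker_mk']
    exact ⟨y, y.2, rfl⟩
  have hπ := QuotientAddGroup.mk'_surjective N
  have hcard : Nat.card (M ⧸ N) = p ^ m := by
    rw [← hidx, ← relIndex_map_self hinj hM hle]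
    rfl
  have : Finite (M ⧸ N) := Nat.finite_of_card_ne_zero (by
    rw [hcard]; exact pow_ne_zero _ hp.ne_zero)
  exact card_addSubgroup_comap_nsmul_eq_of_card hinj hπ (QuotientAddGroup.ker_mk' N) hcard hr hrm s

/-! ### The counting polynomials and their recursion -/

open Polynomial in
/-- The counting polynomial for subgroups `L` of `A = ℤ ^ m` such that `p ^ t A ≤ L`, the index of
`p ^ t A` in `L` is `p ^ k` and the image of `L` in `A / pA` has order `p ^ s`. The recursion runs
over the order `p ^ r` of the image in `A / pA` of `{x | p • x ∈ L}`. -/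
noncomputable def subgroupPoly (m : ℕ) : ℕ → ℕ → ℕ → ℕ[X]
  | 0, k, s => if k = 0 ∧ s = m then 1 else 0
  | t + 1, k, s =>
    if s ≤ k then
      ∑ r ∈ Finset.range (m + 1), subgroupPoly m t (k - s) r * (X ^ (s * (m - r)) * gaussBinom r s)
    else 0

theorem exists_natDegree_sum_le {R ι : Type*} [Semiring R] {I : Finset ι}
    {f : ι → Polynomial R} (h : ∑ i ∈ I, f i ≠ 0) :
    ∃ i ∈ I, f i ≠ 0 ∧ (∑ i ∈ I, f i).natDegree ≤ (f i).natDegree := by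
  have h1 : (∑ i ∈ I, f i).coeff (∑ i ∈ I, f i).natDegree ≠ 0 := by simpa using h
  rw [Polynomial.finsetSum_coeff] at h1
  obtain ⟨i, hi, hi'⟩ := Finset.exists_ne_zero_of_sum_ne_zero h1
  exact ⟨i, hi, fun h0 => hi' (by rw [h0, Polynomial.coeff_zero]),
    Polynomial.le_natDegree_of_ne_zero hi'⟩

/-- No cancellation occurs in sums of polynomials with natural number coefficients. -/
theorem le_natDegree_sum_nat {ι : Type*} {I : Finset ι} {f : ι → Polynomial ℕ} {i : ι}
    (hi : i ∈ I) (h : f i ≠ 0) :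
    ∑ i ∈ I, f i ≠ 0 ∧ (f i).natDegree ≤ (∑ i ∈ I, f i).natDegree := by
  have h1 : (∑ i ∈ I, f i).coeff (f i).natDegree ≠ 0 := by
    rw [Polynomial.finsetSum_coeff]
    intro h0
    have := (Finset.sum_eq_zero_iff.1 h0) i hi
    simp [h] at this
  exact ⟨fun h0 => h1 (by rw [h0, Polynomial.coeff_zero]), Polynomial.le_natDegree_of_ne_zero h1⟩

theorem natDegree_X_pow_mul_gaussBinom {m r s : ℕ} (hs : s ≤ r) (hr : r ≤ m) :
    (Polynomial.X ^ (s * (m - r)) * gaussBinom r s).natDegree = s * (m - s) := by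
  rw [Polynomial.natDegree_mul (by simp) (gaussBinom_ne_zero hs), Polynomial.natDegree_X_pow,
    natDegree_gaussBinom hs, ← mul_add]
  congr 1
  omega

/-- At integers, the concave function `s ↦ s * (m - s)` lies on or below its secant line through
the consecutive integers `b` and `b + 1`, so the degree is at most the sum of the values of this line. -/
theorem natDegree_subgroupPoly_le (m : ℕ) (b : ℤ) {t k s : ℕ} (h : subgroupPoly m t k s ≠ 0) :
    ((subgroupPoly m t k s).natDegree : ℤ) ≤ (m - 2 * b - 1) * k + t * (b * (b + 1)) := by
  induction t generalizing k s with
  | zero =>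
    unfold subgroupPoly at h ⊢
    split_ifs at h ⊢ with h0
    · simp [h0.1]
    · exact absurd rfl h
  | succ t ih =>
    unfold subgroupPoly at h ⊢
    split_ifs at h ⊢ with hsk
    · obtain ⟨r, hr, hne, hle⟩ := exists_natDegree_sum_le h
      have hF := left_ne_zero_of_mul hne
      have hG := right_ne_zero_of_mul hne
      have hrm : r ≤ m := by simpa [Nat.lt_succ_iff] using hr
      have hs : s ≤ r := by
        by_contra hs
        exact hG (by rw [gaussBinom_eq_zero (by omega), mul_zero])
      rw [Polynomial.natDegree_mul hF hG, natDegree_X_pow_mul_gaussBinom hs hrm] at hle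
      have h1 := ih hF
      have h2 : 0 ≤ ((s : ℤ) - b) * (s - b - 1) := by
        obtain h | h := le_or_gt (s : ℤ) b
        · exact mul_nonneg_of_nonpos_of_nonpos (by omega) (by omega)
        · exact mul_nonneg (by omega) (by omega)
      refine (Int.ofNat_le.2 hle).trans ?_
      push_cast [Nat.cast_sub hsk, Nat.cast_sub (hs.trans hrm)] at h1 ⊢
      linear_combination h1 + h2
    · exact absurd rfl h

/-- Prolonging a chain by `j` terms equal to `s` contributes `j * (s * (m - s))` to the degree. -/
theorem exists_le_natDegree_subgroupPoly {m t k s e : ℕ}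
    (h : ∃ r, s ≤ r ∧ r ≤ m ∧ subgroupPoly m t k r ≠ 0 ∧ e ≤ (subgroupPoly m t k r).natDegree)
    (j : ℕ) :
    ∃ r, s ≤ r ∧ r ≤ m ∧ subgroupPoly m (t + j) (k + j * s) r ≠ 0 ∧
      e + j * (s * (m - s)) ≤ (subgroupPoly m (t + j) (k + j * s) r).natDegree := by
  induction j with
  | zero => simpa using h
  | succ j ih =>
    obtain ⟨r, hsr, hrm, hne, he⟩ := ih
    refine ⟨s, le_rfl, hsr.trans hrm, ?_⟩
    have hG : Polynomial.X ^ (s * (m - r)) * gaussBinom r s ≠ 0 :=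
      mul_ne_zero (by simp) (gaussBinom_ne_zero hsr)
    have h1 := le_natDegree_sum_nat (I := Finset.range (m + 1))
      (f := fun r => subgroupPoly m (t + j) (k + j * s) r *
        (Polynomial.X ^ (s * (m - r)) * gaussBinom r s)) (i := r)
      (Finset.mem_range.2 (by omega)) (mul_ne_zero hne hG)
    have h2 : subgroupPoly m (t + (j + 1)) (k + (j + 1) * s) s =
        ∑ r ∈ Finset.range (m + 1), subgroupPoly m (t + j) (k + j * s) r *
          (Polynomial.X ^ (s * (m - r)) * gaussBinom r s) := by
      have h3 : k + (j + 1) * s = k + j * s + s := by ring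
      rw [h3, ← add_assoc, subgroupPoly, if_pos (by omega), Nat.add_sub_cancel]
    rw [h2]
    refine ⟨h1.1, le_trans ?_ h1.2⟩
    rw [Polynomial.natDegree_mul hne hG, natDegree_X_pow_mul_gaussBinom hsr hrm]
    linarith

/-- The subgroups counted by `subgroupPoly m t k s`. -/
def levelSubgroups (A : Type*) [AddCommGroup A] (p t k s : ℕ) : Set (AddSubgroup A) :=
  {L | (nsmulAddMonoidHom (p ^ t) : A →+ A).range ≤ L ∧
    (nsmulAddMonoidHom (p ^ t) : A →+ A).range.relIndex L = p ^ k ∧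
    (nsmulAddMonoidHom p : A →+ A).range.relIndex L = p ^ s}

theorem finite_setOf_le_addSubgroup {A : Type*} [AddCommGroup A] {N : AddSubgroup A}
    (hN : N.index ≠ 0) : {L : AddSubgroup A | N ≤ L}.Finite := by
  have : Finite (A ⧸ N) := AddSubgroup.index_ne_zero_iff_finite.1 hN
  have : Finite (AddSubgroup (A ⧸ N)) := Finite.of_injective _ SetLike.coe_injective
  refine Set.Finite.of_finite_image (f := AddSubgroup.map (QuotientAddGroup.mk' N))
    (Set.toFinite _) fun L hL L' hL' h => ?_
  have h1 := congrArg (AddSubgroup.comap (QuotientAddGroup.mk' N)) h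
  rwa [AddSubgroup.comap_map_eq_self (by simpa using hL),
    AddSubgroup.comap_map_eq_self (by simpa using hL')] at h1

section count

variable {A : Type*} [AddCommGroup A] {p m : ℕ}

theorem range_nsmul_pow_succ (p t : ℕ) :
    (nsmulAddMonoidHom (p ^ (t + 1)) : A →+ A).range =
      (nsmulAddMonoidHom (p ^ t) : A →+ A).range.map (nsmulAddMonoidHom p) := by
  rw [AddMonoidHom.map_range]
  congr 1
  ext x
  simp [pow_succ', mul_smul]

theorem index_range_nsmul_pow_ne_zero (hp : p.Prime)
    (hinj : Function.Injective (nsmulAddMonoidHom p : A →+ A))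
    (hidx : (nsmulAddMonoidHom p : A →+ A).range.index = p ^ m) (t : ℕ) :
    (nsmulAddMonoidHom (p ^ t) : A →+ A).range.index ≠ 0 := by
  induction t with
  | zero =>
    have : (nsmulAddMonoidHom (p ^ 0) : A →+ A).range = ⊤ :=
      AddMonoidHom.range_eq_top.2 fun x => ⟨x, by simp⟩
    rw [this, AddSubgroup.index_top]
    exact one_ne_zero
  | succ t ih =>
    rw [range_nsmul_pow_succ, AddSubgroup.index_map_of_injective _ hinj, hidx]
    exact mul_ne_zero ih (pow_ne_zero _ hp.ne_zero)

theorem finite_levelSubgroups (hp : p.Prime)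
    (hinj : Function.Injective (nsmulAddMonoidHom p : A →+ A))
    (hidx : (nsmulAddMonoidHom p : A →+ A).range.index = p ^ m) (t k s : ℕ) :
    (levelSubgroups A p t k s).Finite :=
  (finite_setOf_le_addSubgroup (index_range_nsmul_pow_ne_zero hp hinj hidx t)).subset
    fun _ hL => hL.1

/-- Passing from `L` to `{x | p • x ∈ L}` lowers the level by one. -/
theorem mem_levelSubgroups_succ (hp : p.Prime)
    (hinj : Function.Injective (nsmulAddMonoidHom p : A →+ A))
    (hidx : (nsmulAddMonoidHom p : A →+ A).range.index = p ^ m) {t k s : ℕ} {L : AddSubgroup A} :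
    L ∈ levelSubgroups A p (t + 1) k s ↔ s ≤ k ∧
      (∃ r ∈ Finset.range (m + 1),
        L.comap (nsmulAddMonoidHom p) ∈ levelSubgroups A p t (k - s) r) ∧
      (nsmulAddMonoidHom p : A →+ A).range.relIndex L = p ^ s := by
  set φ : A →+ A := nsmulAddMonoidHom p
  have hidx' (M : AddSubgroup A) : ∃ r ∈ Finset.range (m + 1), φ.range.relIndex M = p ^ r := by
    have h1 : φ.range.relIndex M ∣ p ^ m := by
      rw [← hidx]
      exact AddSubgroup.relIndex_dvd_index_of_normal _ _
    obtain ⟨r, hr, h⟩ := (Nat.dvd_prime_pow hp).1 h1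
    exact ⟨r, Finset.mem_range.2 (by omega), h⟩
  have hmul (hL : (nsmulAddMonoidHom (p ^ t) : A →+ A).range ≤ L.comap φ)
      (hs : φ.range.relIndex L = p ^ s) :
      (nsmulAddMonoidHom (p ^ (t + 1)) : A →+ A).range.relIndex L =
        (nsmulAddMonoidHom (p ^ t) : A →+ A).range.relIndex (L.comap φ) * p ^ s := by
    rw [range_nsmul_pow_succ, ← hs, relIndex_range_eq_relIndex_map_comap φ,
      ← AddSubgroup.relIndex_mul_relIndex _ _ L (AddSubgroup.map_mono hL)
        (AddSubgroup.map_comap_le _ _),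
      AddSubgroup.relIndex_map_map_of_injective _ _ hinj]
  have hle : (nsmulAddMonoidHom (p ^ (t + 1)) : A →+ A).range ≤ L ↔
      (nsmulAddMonoidHom (p ^ t) : A →+ A).range ≤ L.comap φ := by
    rw [range_nsmul_pow_succ, AddSubgroup.map_le_iff_le_comap]
  constructor
  · rintro ⟨h1, h2, h3⟩
    rw [hmul (hle.1 h1) h3] at h2
    have hsk : s ≤ k := (Nat.pow_dvd_pow_iff_le_right hp.one_lt).1 ⟨_, by rw [mul_comm, h2]⟩
    obtain ⟨r, hr, h⟩ := hidx' (L.comap φ)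
    refine ⟨hsk, ⟨r, hr, hle.1 h1, ?_, h⟩, h3⟩
    rw [← Nat.sub_add_cancel hsk, pow_add] at h2
    simpa using Nat.eq_of_mul_eq_mul_right (pow_pos hp.pos s) h2
  · rintro ⟨hsk, ⟨r, -, h1, h2, -⟩, h3⟩
    refine ⟨hle.2 h1, ?_, h3⟩
    rw [hmul h1 h3, h2, ← pow_add, Nat.sub_add_cancel hsk]

theorem card_levelSubgroups (hp : p.Prime)
    (hinj : Function.Injective (nsmulAddMonoidHom p : A →+ A))
    (hidx : (nsmulAddMonoidHom p : A →+ A).range.index = p ^ m) (t k s : ℕ) :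
    Nat.card (levelSubgroups A p t k s) = (subgroupPoly m t k s).eval p := by
  set φ : A →+ A := nsmulAddMonoidHom p with hφ
  induction t generalizing k s with
  | zero =>
    have htop : (nsmulAddMonoidHom (p ^ 0) : A →+ A).range = ⊤ :=
      AddMonoidHom.range_eq_top.2 fun x => ⟨x, by simp⟩
    have h1 : levelSubgroups A p 0 k s = {L | L = ⊤ ∧ k = 0 ∧ s = m} := by
      ext L
      simp only [levelSubgroups, htop, top_le_iff, Set.mem_ofPred_eq, and_congr_right_iff]
      rintro rfl
      rw [AddSubgroup.relIndex_self, AddSubgroup.relIndex_top_right, hidx,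
        (Nat.pow_right_injective hp.two_le).eq_iff, eq_comm (a := m), eq_comm (a := 1),
        Nat.pow_eq_one]
      simp [hp.ne_one]
    rw [h1, subgroupPoly]
    split_ifs with h0
    · simp [h0]
    · simp [h0]
  | succ t ih =>
    rw [subgroupPoly]
    split_ifs with hsk
    · have hfin r := (finite_levelSubgroups hp hinj hidx t (k - s) r).to_subtype
      have hM (r : ℕ) (M : AddSubgroup A) (hM : M ∈ levelSubgroups A p t (k - s) r) :
          M.index ≠ 0 := fun h0 => index_range_nsmul_pow_ne_zero hp hinj hidx t (by
        rw [← AddSubgroup.relIndex_mul_index hM.1, h0, mul_zero])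
      have hfib (r : Fin (m + 1)) (M : levelSubgroups A p t (k - s) r) :
          Nat.card {L : AddSubgroup A // L.comap φ = M ∧ φ.range.relIndex L = p ^ s} =
            p ^ (s * (m - r)) * (gaussBinom r s).eval p :=
        card_addSubgroup_comap_nsmul_eq hp hinj hidx (hM r M M.2) M.2.2.2 (by omega) s
      have hfibfin (M : AddSubgroup A) (h0 : M.index ≠ 0) :
          Finite {L : AddSubgroup A // L.comap φ = M ∧ φ.range.relIndex L = p ^ s} := by
        refine ((finite_setOf_le_addSubgroup (N := M.map φ) ?_).subset ?_).to_subtype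
        · rw [AddSubgroup.index_map_of_injective _ hinj, hidx]
          exact mul_ne_zero h0 (pow_ne_zero _ hp.ne_zero)
        · rintro L ⟨rfl, -⟩
          exact AddSubgroup.map_comap_le _ _
      have hbij : Nat.card (Σ r : Fin (m + 1), Σ M : levelSubgroups A p t (k - s) r,
          {L : AddSubgroup A // L.comap φ = M ∧ φ.range.relIndex L = p ^ s}) =
          Nat.card (levelSubgroups A p (t + 1) k s) := by
        refine Nat.card_eq_of_bijective (fun x => ⟨x.2.2.1,
          (mem_levelSubgroups_succ hp hinj hidx).2 ⟨hsk, ⟨x.1, Finset.mem_range.2 x.1.2,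
            by rw [← hφ, x.2.2.2.1]; exact x.2.1.2⟩, x.2.2.2.2⟩⟩) ⟨?_, ?_⟩
        · rintro ⟨r, ⟨M, hM⟩, L, hLM, hL⟩ ⟨r', ⟨M', hM'⟩, L', hLM', hL'⟩ h
          obtain rfl : L = L' := congrArg Subtype.val h
          obtain rfl : L.comap φ = M := hLM
          obtain rfl : L.comap φ = M' := hLM'
          obtain rfl : r = r' :=
            Fin.ext (Nat.pow_right_injective hp.two_le (hM.2.2.symm.trans hM'.2.2))
          rfl
        · rintro ⟨L, hL⟩
          obtain ⟨-, ⟨r, hr, h1⟩, h2⟩ := (mem_levelSubgroups_succ hp hinj hidx).1 hL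
          exact ⟨⟨⟨r, Finset.mem_range.1 hr⟩, ⟨_, h1⟩, L, rfl, h2⟩, rfl⟩
      have hsum (r : Fin (m + 1)) : Nat.card (Σ M : levelSubgroups A p t (k - s) r,
          {L : AddSubgroup A // L.comap φ = M ∧ φ.range.relIndex L = p ^ s}) =
          (subgroupPoly m t (k - s) r).eval p *
            (p ^ (s * (m - r)) * (gaussBinom r s).eval p) := by
        have := Fintype.ofFinite (levelSubgroups A p t (k - s) r)
        have (M : levelSubgroups A p t (k - s) r) := hfibfin M (hM r M M.2)
        rw [Nat.card_sigma, Finset.sum_congr rfl (fun M _ => hfib r M), Finset.sum_const,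
          Finset.card_univ, ← Nat.card_eq_fintype_card, smul_eq_mul, ih]
      have (r : Fin (m + 1)) : Finite (Σ M : levelSubgroups A p t (k - s) r,
          {L : AddSubgroup A // L.comap φ = M ∧ φ.range.relIndex L = p ^ s}) := by
        have (M : levelSubgroups A p t (k - s) r) := hfibfin M (hM r M M.2)
        infer_instance
      rw [← hbij, Nat.card_sigma, Finset.sum_congr rfl (fun r _ => hsum r),
        Polynomial.eval_finsetSum, Finset.sum_range]
      simp
    · rw [Polynomial.eval_zero, Set.eq_empty_of_forall_notMem (s := levelSubgroups A p (t + 1) k s)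
        fun L hL => hsk ((mem_levelSubgroups_succ hp hinj hidx).1 hL).1]
      simp

end count

/-! ### Subgroups of `(ℤ / p ^ t) ^ m` -/

/-- Coordinatewise reduction `ℤ ^ m → (ℤ / q) ^ m`. -/
def reductionHom (m q : ℕ) : (Fin m → ℤ) →+ (Fin m → ZMod q) where
  toFun x i := (x i : ZMod q)
  map_zero' := by ext; simp
  map_add' x y := by ext; simp

theorem reductionHom_surjective (m q : ℕ) : Function.Surjective (reductionHom m q) := fun y =>
  ⟨fun i => (ZMod.intCast_surjective (y i)).choose,
    funext fun i => (ZMod.intCast_surjective (y i)).choose_spec⟩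

theorem ker_reductionHom (m q : ℕ) :
    (reductionHom m q).ker = (nsmulAddMonoidHom q : (Fin m → ℤ) →+ (Fin m → ℤ)).range := by
  ext x
  have h1 : x ∈ (reductionHom m q).ker ↔ ∀ i, (q : ℤ) ∣ x i := by
    rw [AddMonoidHom.mem_ker, funext_iff]
    exact forall_congr' fun i => ZMod.intCast_zmod_eq_zero_iff_dvd (x i) q
  rw [h1]
  constructor
  · intro h
    choose y hy using h
    exact ⟨y, funext fun i => by simp [hy i]⟩
  · rintro ⟨y, rfl⟩ i
    exact ⟨y i, by simp⟩

theorem nsmulAddMonoidHom_int_injective {m q : ℕ} (hq : q ≠ 0) :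
    Function.Injective (nsmulAddMonoidHom q : (Fin m → ℤ) →+ (Fin m → ℤ)) := fun x y h =>
  funext fun i => by simpa [hq] using congrFun h i

theorem index_range_nsmul_int (m q : ℕ) :
    (nsmulAddMonoidHom q : (Fin m → ℤ) →+ (Fin m → ℤ)).range.index = q ^ m := by
  rw [← ker_reductionHom, AddSubgroup.index_ker,
    AddMonoidHom.range_eq_top.2 (reductionHom_surjective m q), AddSubgroup.card_top,
    Nat.card_fun, Nat.card_zmod, Nat.card_fin]

theorem card_addSubgroup_pi_zmod {p : ℕ} (hp : p.Prime) (m t k : ℕ) :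
    Nat.card {H : AddSubgroup (Fin m → ZMod (p ^ t)) // Nat.card H = p ^ k} =
      ∑ s ∈ Finset.range (m + 1), (subgroupPoly m t k s).eval p := by
  have hinj := nsmulAddMonoidHom_int_injective (m := m) hp.ne_zero
  have hidx := index_range_nsmul_int m p
  set π := reductionHom m (p ^ t)
  have hπ : Function.Surjective π := reductionHom_surjective m (p ^ t)
  have hker : π.ker = _ := ker_reductionHom m (p ^ t)
  have hcard (H : AddSubgroup (Fin m → ZMod (p ^ t))) :
      π.ker.relIndex (H.comap π) = Nat.card H := by
    rw [AddSubgroup.relIndex_ker, AddSubgroup.map_comap_eq_self_of_surjective hπ]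
  have hfin (s : ℕ) := (finite_levelSubgroups hp hinj hidx t k s).to_subtype
  have hbij : Nat.card (Σ s : Fin (m + 1), levelSubgroups (Fin m → ℤ) p t k s) =
      Nat.card {H : AddSubgroup (Fin m → ZMod (p ^ t)) // Nat.card H = p ^ k} := by
    have hco (s : ℕ) (L : levelSubgroups (Fin m → ℤ) p t k s) :
        (L.1.map π).comap π = L.1 :=
      AddSubgroup.comap_map_eq_self (hker.trans_le L.2.1)
    refine Nat.card_eq_of_bijective (fun x => ⟨x.2.1.map π, ?_⟩) ⟨?_, ?_⟩
    · rw [← hcard, hco, hker, x.2.2.2.1]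
    · rintro ⟨s, L⟩ ⟨s', L'⟩ h
      have h1 := congrArg (AddSubgroup.comap π) (congrArg Subtype.val h)
      simp only [hco] at h1
      obtain ⟨L, hL⟩ := L
      obtain ⟨L', hL'⟩ := L'
      obtain rfl : L = L' := h1
      obtain rfl : s = s' :=
        Fin.ext (Nat.pow_right_injective hp.two_le (hL.2.2.symm.trans hL'.2.2))
      rfl
    · rintro ⟨H, hH⟩
      have h1 : (nsmulAddMonoidHom p : (Fin m → ℤ) →+ _).range.relIndex (H.comap π) ∣ p ^ m := by
        rw [← hidx]
        exact AddSubgroup.relIndex_dvd_index_of_normal _ _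
      obtain ⟨s, hs, h2⟩ := (Nat.dvd_prime_pow hp).1 h1
      refine ⟨⟨⟨s, by omega⟩, H.comap π, ?_, ?_, h2⟩,
        Subtype.ext (AddSubgroup.map_comap_eq_self_of_surjective hπ H)⟩
      · rw [← hker]
        exact AddMonoidHom.ker_le_comap _ _
      · rw [← hker, hcard, hH]
  rw [← hbij, Nat.card_sigma, Finset.sum_range]
  exact Finset.sum_congr rfl fun s _ => card_levelSubgroups hp hinj hidx t k s

/-- The degree of the sum of the counting polynomials, where `k = b * t + d`. The chain with `d`
terms `b + 1` followed by `t - d` terms `b` attains the upper bound. -/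
theorem natDegree_sum_subgroupPoly {m t k b d : ℕ} (hk : k = b * t + d) (hd : d < t)
    (hkm : k ≤ t * m) :
    ∑ s ∈ Finset.range (m + 1), subgroupPoly m t k s ≠ 0 ∧
    ((∑ s ∈ Finset.range (m + 1), subgroupPoly m t k s).natDegree : ℤ) =
      (m - 2 * b - 1) * k + t * (b * (b + 1)) := by
  have hbm : b ≤ m := by
    by_contra h
    have : t * (m + 1) ≤ t * b := Nat.mul_le_mul_left t (by omega)
    rw [mul_comm b] at hk
    rw [mul_add] at this
    omega
  have hbm' : d ≠ 0 → b + 1 ≤ m := fun h0 => by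
    by_contra h
    have : t * m ≤ t * b := Nat.mul_le_mul_left t (by omega)
    rw [mul_comm b] at hk
    omega
  have hstart : ∃ r, b ≤ r ∧ r ≤ m ∧ subgroupPoly m d (d * (b + 1)) r ≠ 0 ∧
      d * ((b + 1) * (m - (b + 1))) ≤ (subgroupPoly m d (d * (b + 1)) r).natDegree := by
    obtain rfl | h0 := eq_or_ne d 0
    · exact ⟨m, hbm, le_rfl, by simp [subgroupPoly], by simp⟩
    · obtain ⟨r, h1, h2, h3, h4⟩ := exists_le_natDegree_subgroupPoly
        (m := m) (t := 0) (k := 0) (s := b + 1) (e := 0)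
        ⟨m, hbm' h0, le_rfl, by simp [subgroupPoly], by simp⟩ d
      simp only [zero_add] at h3 h4
      exact ⟨r, by omega, h2, h3, h4⟩
  obtain ⟨r, -, hrm, hne, hle⟩ := exists_le_natDegree_subgroupPoly hstart (t - d)
  have ht : d + (t - d) = t := by omega
  have hk' : d * (b + 1) + (t - d) * b = k := by
    obtain ⟨e, rfl⟩ := Nat.exists_eq_add_of_lt hd
    rw [hk, show d + e + 1 - d = e + 1 by omega]
    ring
  rw [ht, hk'] at hne hle
  obtain ⟨hS, hS'⟩ := le_natDegree_sum_nat (I := Finset.range (m + 1))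
    (f := fun s => subgroupPoly m t k s) (Finset.mem_range.2 (by omega : r < m + 1)) hne
  refine ⟨hS, le_antisymm ?_ ?_⟩
  · obtain ⟨s, -, h1, h2⟩ := exists_natDegree_sum_le hS
    exact (Int.ofNat_le.2 h2).trans (natDegree_subgroupPoly_le m b h1)
  · refine le_trans (le_of_eq ?_) (Int.ofNat_le.2 (hle.trans hS'))
    have h3 : ((d * ((b + 1) * (m - (b + 1))) : ℕ) : ℤ) = d * ((b + 1) * (m - (b + 1))) := by
      obtain rfl | h0 := eq_or_ne d 0
      · simp
      · push_cast [Nat.cast_sub (hbm' h0)]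
        ring
    rw [Nat.cast_add, h3]
    push_cast [Nat.cast_sub hd.le, Nat.cast_sub hbm, hk]
    ring

theorem theorem2p12 (n t k : ℕ) (hn : 1 < n) (ht : 0 < t) (hk : k ≤ t * (n - 1))
    (b c : ℤ) (hb : b = ⌊(k : ℚ) / (t : ℚ)⌋) (hc : c = ⌈(k : ℚ) / (t : ℚ)⌉) :
    ∃ P : Polynomial ℤ, P ≠ 0 ∧
      (P.natDegree : ℤ) =
        (k : ℤ) * ((n : ℤ) - 1) - c ^ 2 * ((k : ℤ) + (t : ℤ) - c * (t : ℤ))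
          - b ^ 2 * (c * (t : ℤ) - (k : ℤ)) ∧
      ∀ p : ℕ, p.Prime →
        (Nat.card {H : AddSubgroup (Fin (n - 1) → ZMod (p ^ t)) // Nat.card H = p ^ k} : ℤ) =
          P.eval (p : ℤ) := by
  have hkt : k = k / t * t + k % t := (Nat.div_add_mod' k t).symm
  obtain ⟨hne, hdeg⟩ := natDegree_sum_subgroupPoly hkt (Nat.mod_lt k ht) hk
  have hinj : Function.Injective (Nat.castRingHom ℤ) := Nat.cast_injective
  refine ⟨(∑ s ∈ Finset.range (n - 1 + 1), subgroupPoly (n - 1) t k s).map (Nat.castRingHom ℤ),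
    (Polynomial.map_ne_zero_iff hinj).2 hne, ?_, fun p hp => ?_⟩
  · rw [Polynomial.natDegree_map_eq_of_injective hinj, hdeg]
    have hb' : b = (k / t : ℕ) := by
      rw [hb, ← Int.natCast_floor_eq_floor (by positivity), Nat.floor_div_eq_div]
    have htQ : (0 : ℚ) < t := by exact_mod_cast ht
    -- Either `t` divides `k` and `c = b`, or `c = b + 1`.
    have hc' : (c = b ∧ (k : ℤ) = b * t) ∨ c = b + 1 := by
      have h1 : (k : ℤ) = b * t + (k % t : ℕ) := by rw [hb']; exact_mod_cast hkt
      have hlt := Nat.mod_lt k ht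
      generalize k % t = e at h1 hlt
      obtain h0 | h0 := eq_or_ne e 0
      · rw [h0, Nat.cast_zero, add_zero] at h1
        refine Or.inl ⟨?_, h1⟩
        rw [hc, Int.ceil_eq_iff, lt_div_iff₀ htQ, div_le_iff₀ htQ]
        have h2 : (k : ℚ) = b * t := by exact_mod_cast h1
        rw [h2]
        exact ⟨by linarith, le_rfl⟩
      · refine Or.inr ?_
        rw [hc, Int.ceil_eq_iff, lt_div_iff₀ htQ, div_le_iff₀ htQ]
        have h2 : (k : ℚ) = b * t + e := by exact_mod_cast h1
        have h3 : (0 : ℚ) < e := by exact_mod_cast Nat.pos_of_ne_zero h0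
        have h4 : (e : ℚ) < t := by exact_mod_cast hlt
        push_cast
        exact ⟨by linarith, by linarith⟩
    rw [← hb', Nat.cast_sub hn.le, Nat.cast_one]
    obtain ⟨h1, h2⟩ | h1 := hc'
    · rw [h1, h2]
      ring
    · rw [h1]
      ring
  · rw [card_addSubgroup_pi_zmod hp, ← Polynomial.eval_finsetSum, Polynomial.eval_natCast_map]
    simp
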